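/- Let $G$ be a finite group and let $\operatorname{Irr} G$ be the set of its irreducible complex characters. For $X\subseteq \operatorname{Irr} G$ put $\sigma_X=\sum_{\chi\in X}\chi(1)\chi$, and for $K\subseteq G$ and $\chi\in\operatorname{Irr}G$ put $\chi(\hat K)=\sum_{g\in K}\chi(g)$. For a collection $\mathcal X$ of subsets of $\operatorname{Irr}G$ let $C(\mathcal X)$ be the partition of $G$ into the classes of the relation $g\sim h\iff \sigma_X(g)=\sigma_X(h)$ for all $X\in\mathcal X$. For a collection $\mathcal K$ of conjugation-invariant subsets of $G$ let $I(\mathcal K)$ be the partition of $\operatorname{Irr}G$ into the classes of the relation $\chi\sim\psi\iff \chi(\hat K)/\chi(1)=\psi(\hat K)/\psi(1)$ for all $K\in\mathcal K$. A partition of $G$ is called $G$-invariant if all its blocks are conjugation-invariant. A partition $\mathcal A$ refines (is finer than) a partition $\mathcal B$ if every block of $\mathcal A$ is contained in a block of $\mathcal B$. A supercharacter theory of $G$ is a pair $(\mathcal X,\mathcal K)$ of a partition $\mathcal X$ of $\operatorname{Irr}G$ and a partition $\mathcal K$ of $G$ such that $|\mathcal X|=|\mathcal K|$ and $\sigma_X$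 is constant on every $K\in\mathcal K$, for every $X\in\mathcal X$. A supercharacter theory $(\mathcal X,\mathcal K)$ is the coarsest one with a given property if it has the property and, for every supercharacter theory $(\mathcal Y,\mathcal L)$ with the property, $\mathcal Y$ refines $\mathcal X$ and $\mathcal L$ refines $\mathcal K$. (a) Let $\mathcal K$ be a $G$-invariant partition of $G$. Then the sequence $(CI)^n(\mathcal K)$, $n\ge 0$, is eventually constant. Whenever $n\ge 0$ satisfies $(CI)^{n+1}(\mathcal K)=(CI)^n(\mathcal K)$, the pair $\bigl(I(CI)^n(\mathcal K),\,(CI)^n(\mathcal K)\bigr)$ is the coarsest supercharacter theory of $G$ whose class partition refines $\mathcal K$. (b) Let $\mathcal X$ be a partition of $\operatorname{Irr}G$. Then the sequence $(IC)^n(\mathcal X)$, $n\ge 0$, is eventually constant. Whenever $n\ge 0$ satisfies $(IC)^{n+1}(\mathcal X)=(IC)^n(\mathcal X)$, the pair $\bigl((IC)^n(\mathcal X),\,C(IC)^n(\mathcal X)\bigr)$ is the coarsest supercharacter theory of $G$ whose character partition refines $\mathcal X$. -/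

import Mathlib

noncomputable section

namespace SCT

/-- `χ : G → ℂ` is an irreducible complex character of `G`: the character of an irreducible
representation of `G` on some `ℂⁿ`. -/
def IsIrrChar {G : Type*} [Group G] (χ : G → ℂ) : Prop :=
  ∃ (n : ℕ) (ρ : Representation ℂ G (Fin n → ℂ)), ρ.IsIrreducible ∧ ρ.character = χ

/-- `Irr G`, the set of irreducible complex characters of `G`, as a type. -/
abbrev Irr (G : Type*) [Group G] : Type _ := {χ : G → ℂ // IsIrrChar χ}

/-- First orthogonality relation, without normalisation. -/
theorem irr_orthogonality {G : Type*} [Group G] [Fintype G] (χ ψ : Irr G) :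
    (∑ g : G, χ.1 g * ψ.1 g⁻¹ ≠ 0) ↔ χ = ψ := by
  classical
  obtain ⟨χ, m, ρ, hρ, rfl⟩ := χ
  obtain ⟨ψ, n, σ, hσ, rfl⟩ := ψ
  have hcard : (Nat.card G : ℂ) ≠ 0 := Nat.cast_ne_zero.mpr Nat.card_pos.ne'
  haveI : Invertible (Nat.card G : ℂ) := invertibleOfNonzero hcard
  have key := Representation.char_orthonormal ρ σ
  constructor
  · intro h
    by_cases he : Nonempty (Representation.Equiv σ ρ)
    · obtain ⟨e⟩ := he
      exact Subtype.ext (Representation.char_iso e).symm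
    · rw [if_neg he] at key
      exact absurd key (mul_ne_zero (inv_ne_zero hcard) h)
  · intro h h0
    have h1 : ρ.character = σ.character := congrArg Subtype.val h
    have key2 := Representation.char_orthonormal ρ ρ
    rw [if_pos ⟨Representation.Equiv.refl ρ⟩] at key2
    have h2 : ∑ g : G, ρ.character g * ρ.character g⁻¹ = 0 := by
      rw [← h0]
      exact Finset.sum_congr rfl fun g _ => by
        show _ = ρ.character g * σ.character g⁻¹
        rw [← h1]
    rw [h2, mul_zero] at key2
    exact zero_ne_one key2

/-- A finite group has only finitely many irreducible characters. -/
instance irr_finite (G : Type*) [Group G] [Finite G] : Finite (Irr G) := by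
  classical
  haveI := Fintype.ofFinite G
  have hli : LinearIndependent ℂ (fun χ : Irr G => χ.1) := by
    rw [linearIndependent_iff']
    intro s c hc ψ hψ
    have h1 : ∑ g : G, (∑ χ ∈ s, c χ • χ.1) g * ψ.1 g⁻¹ = 0 := by
      rw [hc]; simp
    have h2 : ∑ g : G, (∑ χ ∈ s, c χ • χ.1) g * ψ.1 g⁻¹
        = ∑ χ ∈ s, c χ * ∑ g : G, χ.1 g * ψ.1 g⁻¹ := by
      simp only [Finset.sum_apply, Pi.smul_apply, smul_eq_mul, Finset.sum_mul, Finset.mul_sum]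
      rw [Finset.sum_comm]
      simp only [mul_assoc]
    rw [h2, Finset.sum_eq_single ψ] at h1
    · exact (mul_eq_zero.mp h1).resolve_right ((irr_orthogonality ψ ψ).mpr rfl)
    · intro χ _ hne
      rw [not_not.mp (mt (irr_orthogonality χ ψ).mp hne), mul_zero]
    · exact fun h => absurd hψ h
  exact hli.finite

/-- The character `σ_X = ∑_{χ ∈ X} χ(1) χ`. -/
def sigma {G : Type*} [Group G] [Finite G] (X : Set (Irr G)) (g : G) : ℂ :=
  ∑ χ ∈ X.toFinite.toFinset, χ.1 1 * χ.1 g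

/-- The value `χ(K̂) / χ(1)`, where `K̂ = ∑_{g ∈ K} g` in the group algebra and `χ` is extended
linearly to the group algebra. -/
def omega {G : Type*} [Group G] [Finite G] (χ : Irr G) (K : Set G) : ℂ :=
  (∑ g ∈ K.toFinite.toFinset, χ.1 g) / χ.1 1

/-- The relation `g ∼ h` iff `σ_X(g) = σ_X(h)` for all `X ∈ 𝒳`. -/
def classSetoid {G : Type*} [Group G] [Finite G] (𝒳 : Set (Set (Irr G))) : Setoid G where
  r g h := ∀ X ∈ 𝒳, sigma X g = sigma X h
  iseqv := ⟨fun _ _ _ => rfl, fun h X hX => (h X hX).symm,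
    fun h h' X hX => (h X hX).trans (h' X hX)⟩

/-- The relation `χ ∼ ψ` iff `χ(K̂)/χ(1) = ψ(K̂)/ψ(1)` for all `K ∈ 𝒦`. -/
def irrSetoid {G : Type*} [Group G] [Finite G] (𝒦 : Set (Set G)) : Setoid (Irr G) where
  r χ ψ := ∀ K ∈ 𝒦, omega χ K = omega ψ K
  iseqv := ⟨fun _ _ _ => rfl, fun h K hK => (h K hK).symm,
    fun h h' K hK => (h K hK).trans (h' K hK)⟩

/-- The class partition of `G` determined by a collection of subsets of `Irr G`. -/
def Clpt {G : Type*} [Group G] [Finite G] (𝒳 : Set (Set (Irr G))) : Set (Set G) :=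
  (classSetoid 𝒳).classes

/-- The character partition of `Irr G` determined by a collection of (normal) subsets of `G`. -/
def Irpt {G : Type*} [Group G] [Finite G] (𝒦 : Set (Set G)) : Set (Set (Irr G)) :=
  (irrSetoid 𝒦).classes

/-- All members of `𝒦` are normal subsets (unions of conjugacy classes) of `G`. -/
def IsInvariant {G : Type*} [Group G] (𝒦 : Set (Set G)) : Prop :=
  ∀ K ∈ 𝒦, ∀ x ∈ K, ∀ g : G, g * x * g⁻¹ ∈ K

/-- `𝒜` is finer than (refines) `ℬ`: every block of `𝒜` is contained in a block of `ℬ`. -/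
def Refines {S : Type*} (𝒜 ℬ : Set (Set S)) : Prop :=
  ∀ A ∈ 𝒜, ∃ B ∈ ℬ, A ⊆ B

/-- `(𝒳, 𝒦)` is a supercharacter theory of `G`. -/
structure IsSupercharacterTheory {G : Type*} [Group G] [Finite G]
    (𝒳 : Set (Set (Irr G))) (𝒦 : Set (Set G)) : Prop where
  partition_irr : Setoid.IsPartition 𝒳
  partition_group : Setoid.IsPartition 𝒦
  card_eq : 𝒳.ncard = 𝒦.ncard
  const : ∀ X ∈ 𝒳, ∀ K ∈ 𝒦, ∀ g ∈ K, ∀ h ∈ K, sigma X g = sigma X h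

/-- `(𝒳, 𝒦)` is the coarsest among the supercharacter theories of `G` with property `P`: it is
one of them, and each of them is finer than it (in the character partition and in the class
partition). -/
def IsCoarsestSCT {G : Type*} [Group G] [Finite G]
    (P : Set (Set (Irr G)) → Set (Set G) → Prop)
    (𝒳 : Set (Set (Irr G))) (𝒦 : Set (Set G)) : Prop :=
  (IsSupercharacterTheory 𝒳 𝒦 ∧ P 𝒳 𝒦) ∧
    ∀ 𝒴 ℒ, IsSupercharacterTheory 𝒴 ℒ → P 𝒴 ℒ → Refines 𝒴 𝒳 ∧ Refines ℒ 𝒦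

end SCT

end

/-! Partitions are treated as setoids, ordered by refinement, and through the spaces `constOn` of
functions constant on their blocks, whose dimensions count the blocks. The transforms `irrToGroup`
and `groupToIrr` are mutually inverse between functions on `Irr G` and class functions on `G`. Up to
a scalar and complex conjugation they send block indicators to the `σ_X` and to the values
`χ(K̂)/χ(1)`. So `C` and `I` are both instances of `imageSetoid`, the coarsest partition carrying
the transformed functions.

`imageSetoid` is monotone, and inversion makes `CI` (on invariant partitions) and `IC` refine their
argument, so the iterations descend in a finite poset and stop. At a fixed point, injectivity of
both transforms forces equal block counts. Conversely, in any supercharacter theory equal dimensions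
make the transform an isomorphism of the two `constOn` spaces, so each partition refines the image
of the other (`IsSupercharacterTheory.le_imageSetoid`). By monotonicity it then stays below every
iterate. -/

namespace SCT

/-! ### Irreducible characters: unitarity and completeness -/

section Characters

variable {G : Type*} [Group G]

/-- The representation on `ℂⁿ` obtained from a module over the group algebra by choosing
coordinates. -/
noncomputable def coordRep {n : ℕ} {M : Type*} [AddCommGroup M] [Module ℂ M]
    [Module (MonoidAlgebra ℂ G) M] [IsScalarTower ℂ (MonoidAlgebra ℂ G) M]
    (e : M ≃ₗ[ℂ] (Fin n → ℂ)) : Representation ℂ G (Fin n → ℂ) :=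
  (((e.conjAlgEquiv ℂ).toAlgHom.comp
    (Algebra.lsmul ℂ ℂ M : MonoidAlgebra ℂ G →ₐ[ℂ] Module.End ℂ M)) :
      MonoidAlgebra ℂ G →* Module.End ℂ (Fin n → ℂ)).comp (MonoidAlgebra.of ℂ G)

theorem coordRep_apply {n : ℕ} {M : Type*} [AddCommGroup M] [Module ℂ M]
    [Module (MonoidAlgebra ℂ G) M] [IsScalarTower ℂ (MonoidAlgebra ℂ G) M]
    (e : M ≃ₗ[ℂ] (Fin n → ℂ)) (g : G) :
    coordRep (G := G) e g = e.conj (Algebra.lsmul ℂ ℂ M (MonoidAlgebra.of ℂ G g)) := rfl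

theorem coordRep_apply_apply {n : ℕ} {M : Type*} [AddCommGroup M] [Module ℂ M]
    [Module (MonoidAlgebra ℂ G) M] [IsScalarTower ℂ (MonoidAlgebra ℂ G) M]
    (e : M ≃ₗ[ℂ] (Fin n → ℂ)) (g : G) (x : Fin n → ℂ) :
    coordRep (G := G) e g x = e (MonoidAlgebra.of ℂ G g • e.symm x) := rfl

/-- Members of `Irr G` live on coordinate spaces, so simple modules must be transported there before
their traces count as irreducible characters. -/
theorem coordRep_isIrreducible {n : ℕ} {M : Type*} [AddCommGroup M] [Module ℂ M]
    [Module (MonoidAlgebra ℂ G) M] [IsScalarTower ℂ (MonoidAlgebra ℂ G) M]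
    [IsSimpleModule (MonoidAlgebra ℂ G) M]
    (e : M ≃ₗ[ℂ] (Fin n → ℂ)) : (coordRep (G := G) e).IsIrreducible := by
  rw [Representation.irreducible_iff_isSimpleModule_asModule]
  let ρ := coordRep (G := G) e
  let f : ρ.asModule ≃+ M := (ρ.asModuleEquiv.trans e.symm).toAddEquiv
  have hf : ∀ (r : MonoidAlgebra ℂ G) (x : ρ.asModule), f (r • x) = r • f x := by
    intro r x
    induction r using MonoidAlgebra.induction_on with
    | of g =>
      change e.symm (ρ.asModuleEquiv (_ • x)) = _
      rw [Representation.asModuleEquiv_map_smul, Representation.asAlgebraHom_of]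
      simp [ρ, coordRep_apply_apply, f]
    | add a b ha hb => rw [add_smul, map_add, ha, hb, add_smul]
    | smul c a ha =>
      have : f (c • (a • x)) = c • f (a • x) := (ρ.asModuleEquiv.trans e.symm).map_smul c _
      rw [smul_assoc, this, ha, smul_assoc]
  let F : ρ.asModule ≃ₗ[MonoidAlgebra ℂ G] M := { f with map_smul' := hf }
  exact IsSimpleModule.congr F

theorem Irr.one_ne_zero (χ : Irr G) : χ.1 1 ≠ 0 := by
  obtain ⟨_, n, ρ, hρ, rfl⟩ := χ
  change ρ.character 1 ≠ 0
  rw [Representation.char_one]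
  rcases n with _ | n
  · exfalso
    have := (Representation.irreducible_iff_isSimpleModule_asModule ρ).mp hρ
    have h1 := IsSimpleModule.nontrivial (MonoidAlgebra ℂ G) ρ.asModule
    exact not_subsingleton_iff_nontrivial.mpr h1
      (inferInstanceAs (Subsingleton (Fin 0 → ℂ)))
  · simp; norm_cast

theorem Irr.star_one (χ : Irr G) : star (χ.1 1) = χ.1 1 := by
  obtain ⟨_, n, ρ, hρ, rfl⟩ := χ
  change star (ρ.character 1) = ρ.character 1
  simp

theorem Irr.conj_invariant (χ : Irr G) (g h : G) : χ.1 (h * g * h⁻¹) = χ.1 g := by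
  obtain ⟨_, n, ρ, hρ, rfl⟩ := χ
  exact Representation.char_conj ρ g h

open scoped ComplexOrder in
/-- The value of a character of a finite group at `g⁻¹` is the conjugate of its value at `g`. -/
theorem Irr.inv_eq_star [Finite G] (χ : Irr G) (g : G) : χ.1 g⁻¹ = star (χ.1 g) := by
  classical
  have := Fintype.ofFinite G
  obtain ⟨_, n, ρ, hρ, rfl⟩ := χ
  let A : G → Matrix (Fin n) (Fin n) ℂ := fun g => LinearMap.toMatrix' (ρ g)
  have hmul : ∀ a b, A (a * b) = A a * A b := fun a b => by
    simp [A, LinearMap.toMatrix'_mul]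
  have hone : A 1 = 1 := by simp [A]
  have htr : ∀ g, ρ.character g = (A g).trace := fun g => by
    simp only [Representation.character, A]
    rw [LinearMap.trace_eq_matrix_trace ℂ (Pi.basisFun ℂ (Fin n)), LinearMap.toMatrix_eq_toMatrix']
  -- The averaged Hermitian form is invariant, which makes `A g⁻¹` similar to the conjugate
  -- transpose of `A g`.
  let H : Matrix (Fin n) (Fin n) ℂ := ∑ h, (A h).conjTranspose * A h
  have hH : H.PosDef := by
    have h1 : H = 1 + ∑ h ∈ Finset.univ.erase 1, (A h).conjTranspose * A h := by
      simp only [H]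
      rw [← Finset.add_sum_erase _ _ (Finset.mem_univ (1 : G)), hone]
      simp
    rw [h1]
    exact Matrix.PosDef.one.add_posSemidef (Matrix.posSemidef_sum _ fun h _ =>
      Matrix.posSemidef_conjTranspose_mul_self _)
  have hinv : (A g).conjTranspose * H * A g = H := by
    simp only [H, Finset.mul_sum, Finset.sum_mul]
    refine Fintype.sum_equiv (Equiv.mulRight g) _ _ fun h => ?_
    simp [hmul, Matrix.mul_assoc]
  have hu : IsUnit H.det := (Matrix.isUnit_iff_isUnit_det _).mp hH.isUnit
  have h1 : A g * A g⁻¹ = 1 := by rw [← hmul, mul_inv_cancel, hone]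
  have h2 : H * A g⁻¹ = (A g).conjTranspose * H := by
    rw [← hinv, Matrix.mul_assoc _ (A g), h1, hinv, Matrix.mul_one]
  have h3 : A g⁻¹ = H⁻¹ * ((A g).conjTranspose * H) := by
    rw [← h2, Matrix.nonsing_inv_mul_cancel_left _ _ hu]
  change ρ.character g⁻¹ = star (ρ.character g)
  rw [htr, htr, h3, Matrix.trace_mul_comm, Matrix.mul_nonsing_inv_cancel_right _ _ hu,
    Matrix.trace_conjTranspose]

theorem Irr.sum_mul_inv [Fintype G] (χ : Irr G) :
    ∑ g : G, χ.1 g * χ.1 g⁻¹ = Nat.card G := by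
  obtain ⟨_, n, ρ, hρ, rfl⟩ := χ
  have hcard : (Nat.card G : ℂ) ≠ 0 := Nat.cast_ne_zero.mpr Nat.card_pos.ne'
  have : Invertible (Nat.card G : ℂ) := invertibleOfNonzero hcard
  have key := Representation.char_orthonormal ρ ρ
  rw [if_pos ⟨Representation.Equiv.refl ρ⟩] at key
  field_simp at key
  exact key

/-- A class function orthogonal to all irreducible characters vanishes. -/
theorem eq_zero_of_forall_sum_irr_eq_zero [Fintype G] (f : G → ℂ)
    (hf : ∀ g h, f (h * g * h⁻¹) = f g) (h0 : ∀ χ : Irr G, ∑ g, f g * χ.1 g = 0) : f = 0 := by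
  classical
  have hne : NeZero (Nat.card G : ℂ) := ⟨Nat.cast_ne_zero.mpr Nat.card_pos.ne'⟩
  -- This element is central, so by Schur it acts on each simple left ideal as a scalar. The trace
  -- of that action is `∑ f χ = 0`, so the scalar vanishes.
  let z : MonoidAlgebra ℂ G := ∑ g, f g • MonoidAlgebra.of ℂ G g
  have hzg : ∀ h : G, MonoidAlgebra.of ℂ G h * z = z * MonoidAlgebra.of ℂ G h := by
    intro h
    simp only [z, Finset.mul_sum, Finset.sum_mul, mul_smul_comm, smul_mul_assoc, ← map_mul]
    refine Fintype.sum_equiv (MulAut.conj h).toEquiv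
      (fun g => f g • MonoidAlgebra.of ℂ G (h * g))
      (fun g => f g • MonoidAlgebra.of ℂ G (g * h)) fun g => ?_
    simp [hf]
  have hz : ∀ r : MonoidAlgebra ℂ G, r * z = z * r := by
    intro r
    induction r using MonoidAlgebra.induction_on with
    | of g => exact hzg g
    | add a b ha hb => rw [add_mul, mul_add, ha, hb]
    | smul c a ha => rw [smul_mul_assoc, mul_smul_comm, ha]
  have hann : ∀ N : Submodule (MonoidAlgebra ℂ G) (MonoidAlgebra ℂ G),
      IsSimpleModule (MonoidAlgebra ℂ G) N → ∀ x : N, z • x = 0 := by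
    intro N hN x
    let n := Module.finrank ℂ N
    let e : N ≃ₗ[ℂ] (Fin n → ℂ) := (Module.finBasis ℂ N).equivFun
    let ρ := coordRep (G := G) e
    let χ : Irr G := ⟨ρ.character, n, ρ, coordRep_isIrreducible e, rfl⟩
    let φ : Module.End (MonoidAlgebra ℂ G) N :=
      { toFun := fun x => z • x
        map_add' := smul_add z
        map_smul' := fun r x => by
          simp only [RingHom.id_apply, smul_smul, hz] }
    obtain ⟨c, hc⟩ := (IsSimpleModule.algebraMap_end_bijective_of_isAlgClosed
      (A := MonoidAlgebra ℂ G) (V := N) ℂ).2 φ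
    have hc' : ∀ y : N, z • y = c • y := fun y => by
      simpa [φ] using (LinearMap.congr_fun hc y).symm
    have h1 : LinearMap.trace ℂ N (Algebra.lsmul ℂ ℂ N z) = 0 := by
      rw [← h0 χ]
      simp only [z, map_sum, map_smul, smul_eq_mul]
      refine Finset.sum_congr rfl fun g _ => ?_
      change _ = f g * LinearMap.trace ℂ _ (coordRep e g)
      rw [coordRep_apply, LinearMap.trace_conj']
    have h2 : Algebra.lsmul ℂ ℂ N z = c • (1 : Module.End ℂ N) := by
      ext y
      simp [hc']
    rw [h2, map_smul, LinearMap.trace_one, smul_eq_mul] at h1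
    have h3 : (Module.finrank ℂ N : ℂ) ≠ 0 := by
      have := χ.one_ne_zero
      simpa [χ, n] using this
    rw [hc', (mul_eq_zero.mp h1).resolve_right h3, zero_smul]
  -- By semisimplicity the simple left ideals generate the whole algebra, so `z` annihilates `1`.
  have hle : sSup {N : Submodule (MonoidAlgebra ℂ G) (MonoidAlgebra ℂ G) |
      IsSimpleModule (MonoidAlgebra ℂ G) N} ≤
      LinearMap.ker (LinearMap.toSpanSingleton (MonoidAlgebra ℂ G) (MonoidAlgebra ℂ G) z) := by
    refine sSup_le fun N hN x hx => ?_
    have := congrArg Subtype.val (hann N hN ⟨x, hx⟩)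
    simpa [hz] using this
  rw [IsSemisimpleModule.sSup_simples_eq_top] at hle
  have hz0 : z = 0 := by simpa using hle (Submodule.mem_top (x := (1 : MonoidAlgebra ℂ G)))
  ext g
  have := congrArg (fun r : MonoidAlgebra ℂ G => r.coeff g) hz0
  simpa [z, MonoidAlgebra.coeff_sum, Finsupp.single_apply] using this

end Characters

/-! ### Partitions and their spaces of block-constant functions -/

section SetoidFunctions

variable {S T : Type*}

/-- The complex functions constant on the classes of a setoid. -/
def constOn (s : Setoid S) : Submodule ℂ (S → ℂ) where
  carrier := {f | ∀ x y, s x y → f x = f y}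
  add_mem' hf hg x y h := by simp [hf x y h, hg x y h]
  zero_mem' _ _ _ := rfl
  smul_mem' c f hf x y h := by simp [hf x y h]

theorem constOn_anti {s t : Setoid S} (h : s ≤ t) : constOn t ≤ constOn s :=
  fun _ hf x y hxy => hf x y (h hxy)

theorem indicator_mem_constOn {s : Setoid S} {A : Set S} (hA : A ∈ s.classes) :
    A.indicator (1 : S → ℂ) ∈ constOn s := by
  classical
  obtain ⟨z, rfl⟩ := hA
  intro x y h
  have : s x z ↔ s y z := ⟨fun h' => s.trans (s.symm h) h', fun h' => s.trans h h'⟩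
  simp only [Set.indicator_apply, Set.mem_ofPred_eq, this]
  rfl

/-- The functions constant on the classes of `s` are the functions on the quotient by `s`. -/
def constOnEquiv (s : Setoid S) : (Quotient s → ℂ) ≃ₗ[ℂ] constOn s where
  toFun f := ⟨fun x => f ⟦x⟧, fun _ _ h => congrArg f (Quotient.sound h)⟩
  map_add' _ _ := rfl
  map_smul' _ _ := rfl
  invFun f := Quotient.lift f.1 f.2
  left_inv f := by ext q; induction q using Quotient.inductionOn; rfl
  right_inv _ := rfl

theorem finrank_constOn [Finite S] (s : Setoid S) :
    Module.finrank ℂ (constOn s) = s.classes.ncard := by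
  have := Fintype.ofFinite (Quotient s)
  rw [← (constOnEquiv s).finrank_eq, Module.finrank_fintype_fun_eq_card,
    Fintype.card_eq_nat_card, Nat.card_congr (Setoid.quotientEquivClasses s), Nat.card_coe_set_eq]

theorem constOn_le_span [Finite S] (s : Setoid S) :
    constOn s ≤ Submodule.span ℂ ((fun A : Set S => A.indicator 1) '' s.classes) := by
  classical
  have := Fintype.ofFinite (Quotient s)
  intro f hf
  have h : f = ∑ q : Quotient s, f q.out • {x | s x q.out}.indicator (1 : S → ℂ) := by
    ext x
    have hx : s x (⟦x⟧ : Quotient s).out := s.symm (Quotient.mk_out x)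
    rw [Finset.sum_apply, Finset.sum_eq_single (⟦x⟧ : Quotient s)]
    · have : x ∈ {y | s y (⟦x⟧ : Quotient s).out} := hx
      simp [Set.indicator_of_mem this, hf _ _ hx]
    · intro q _ hq
      have : x ∉ {y | s y q.out} := fun h => hq <| by
        rw [← q.out_eq]
        exact (Quotient.sound (s.symm h) : (⟦q.out⟧ : Quotient s) = ⟦x⟧)
      simp [Set.indicator_of_notMem this]
    · exact fun h => absurd (Finset.mem_univ _) h
  rw [h]
  exact Submodule.sum_mem _ fun q _ => Submodule.smul_mem _ _
    (Submodule.subset_span ⟨_, s.mem_classes _, rfl⟩)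

/-- The coarsest setoid on `T` whose classes carry the images under `L` of all functions constant
on the classes of `s`. -/
def imageSetoid (L : (S → ℂ) →ₗ[ℂ] (T → ℂ)) (s : Setoid S) : Setoid T where
  r x y := ∀ f ∈ constOn s, L f x = L f y
  iseqv := ⟨fun _ _ _ => rfl, fun h f hf => (h f hf).symm,
    fun h h' f hf => (h f hf).trans (h' f hf)⟩

theorem imageSetoid_rel_iff [Finite S] {L : (S → ℂ) →ₗ[ℂ] (T → ℂ)} {s : Setoid S} {x y : T} :
    imageSetoid L s x y ↔
      ∀ A ∈ s.classes, L (A.indicator 1) x = L (A.indicator 1) y := by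
  refine ⟨fun h A hA => h _ (indicator_mem_constOn hA), fun h f hf => ?_⟩
  have hspan := constOn_le_span s hf
  clear hf
  induction hspan using Submodule.span_induction with
  | mem f hf => obtain ⟨A, hA, rfl⟩ := hf; exact h A hA
  | zero => simp
  | add f g _ _ hf hg => simp [hf, hg]
  | smul c f _ hf => simp [hf]

theorem map_mem_constOn_imageSetoid (L : (S → ℂ) →ₗ[ℂ] (T → ℂ)) {s : Setoid S} {f : S → ℂ}
    (hf : f ∈ constOn s) : L f ∈ constOn (imageSetoid L s) :=
  fun _ _ h => h f hf

theorem imageSetoid_mono (L : (S → ℂ) →ₗ[ℂ] (T → ℂ)) : Monotone (imageSetoid L) :=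
  fun _ _ hst _ _ h f hf => h f (constOn_anti hst hf)

/-- The indicator of each block of `s` is recovered by `M` from its image under `L`, so it still
separates points of different blocks. -/
theorem imageSetoid_imageSetoid_le {L : (S → ℂ) →ₗ[ℂ] (T → ℂ)} {M : (T → ℂ) →ₗ[ℂ] (S → ℂ)}
    {s : Setoid S} (h : ∀ f ∈ constOn s, M (L f) = f) :
    imageSetoid M (imageSetoid L s) ≤ s := by
  intro x y hxy
  have hA := indicator_mem_constOn (s.mem_classes y)
  have h1 := hxy _ (map_mem_constOn_imageSetoid L hA)
  rw [h _ hA] at h1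
  by_contra hn
  have hx : x ∉ {z | s z y} := hn
  simp [Set.indicator_of_notMem hx] at h1

theorem ncard_classes_le_imageSetoid [Finite S] [Finite T] {L : (S → ℂ) →ₗ[ℂ] (T → ℂ)}
    {M : (T → ℂ) →ₗ[ℂ] (S → ℂ)} {s : Setoid S} (h : ∀ f ∈ constOn s, M (L f) = f) :
    s.classes.ncard ≤ (imageSetoid L s).classes.ncard := by
  rw [← finrank_constOn, ← finrank_constOn]
  refine LinearMap.finrank_le_finrank_of_injective
    (f := L.restrict fun f hf => map_mem_constOn_imageSetoid L hf) fun f g hfg => ?_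
  have h1 : L f.1 = L g.1 := congrArg Subtype.val hfg
  exact Subtype.ext <| by rw [← h _ f.2, h1, h _ g.2]

/-- Equal dimensions turn the injection `L : constOn s → constOn t` into a bijection, so its left
inverse `M` maps `constOn t` back into `constOn s`. -/
theorem le_imageSetoid_of_ncard_eq [Finite S] [Finite T] {L : (S → ℂ) →ₗ[ℂ] (T → ℂ)}
    {M : (T → ℂ) →ₗ[ℂ] (S → ℂ)} {s : Setoid S} {t : Setoid T}
    (h : ∀ f ∈ constOn s, M (L f) = f) (ht : t ≤ imageSetoid L s)
    (hcard : s.classes.ncard = t.classes.ncard) : s ≤ imageSetoid M t := by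
  let L' : constOn s →ₗ[ℂ] constOn t :=
    L.restrict fun f hf => constOn_anti ht (map_mem_constOn_imageSetoid L hf)
  have hinj : Function.Injective L' := fun f g hfg => by
    have h1 : L f.1 = L g.1 := congrArg Subtype.val hfg
    exact Subtype.ext <| by rw [← h _ f.2, h1, h _ g.2]
  have hsurj : Function.Surjective L' :=
    (LinearMap.injective_iff_surjective_of_finrank_eq_finrank
      (by rw [finrank_constOn, finrank_constOn, hcard])).mp hinj
  intro x y hxy f hf
  obtain ⟨a, ha⟩ := hsurj ⟨f, hf⟩
  have h1 : L a.1 = f := congrArg Subtype.val ha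
  rw [← h1, h _ a.2]
  exact a.2 x y hxy

theorem refines_classes_iff {s t : Setoid S} : Refines s.classes t.classes ↔ s ≤ t := by
  constructor
  · intro h x y hxy
    obtain ⟨B, hB, hAB⟩ := h _ (s.mem_classes y)
    exact t.rel_iff_exists_classes.mpr ⟨B, hB, hAB hxy, hAB (s.refl y)⟩
  · rintro h _ ⟨y, rfl⟩
    exact ⟨_, t.mem_classes y, fun x hx => h hx⟩

theorem exists_classes_eq {c : Set (Set S)} (hc : Setoid.IsPartition c) :
    ∃ s : Setoid S, s.classes = c :=
  ⟨_, Setoid.classes_mkClasses c hc⟩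

instance setoid_finite [Finite S] : Finite (Setoid S) :=
  Finite.of_injective (fun s : Setoid S => s.classes) fun _ _ h => Setoid.classes_inj.mpr h

end SetoidFunctions

theorem isInvariant_classes_iff {G : Type*} [Group G] {r : Setoid G} :
    IsInvariant r.classes ↔ ∀ g h : G, r (h * g * h⁻¹) g := by
  constructor
  · exact fun hr g h => hr _ (r.mem_classes g) g (r.refl g) h
  · rintro hr _ ⟨y, rfl⟩ x hx g
    exact r.trans (hr x g) hx

theorem eventually_const_iterate {α : Type*} [PartialOrder α] [Finite α] {F : α → α} {x : α}
    (h : ∀ n, F^[n + 1] x ≤ F^[n] x) : ∃ N, ∀ n ≥ N, F^[n] x = F^[N] x := by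
  obtain ⟨N, hN⟩ := WellFoundedLT.antitone_chain_condition
    (antitone_nat_of_succ_le (f := fun n => F^[n] x) h)
  exact ⟨N, fun n hn => (hN n hn).symm⟩

theorem le_iterate_of_le {α : Type*} [Preorder α] {F : α → α} (hF : Monotone F) {x y : α}
    (hx : x ≤ F x) (hxy : x ≤ y) (n : ℕ) : x ≤ F^[n] y := by
  induction n with
  | zero => exact hxy
  | succ n ih =>
    rw [Function.iterate_succ_apply']
    exact hx.trans (hF ih)

/-! ### The Fourier transforms and their relation to `C` and `I` -/

section Transforms

variable {G : Type*} [Group G] [Finite G]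

/-- The inverse Fourier transform from functions on `Irr G` to class functions on `G`. -/
noncomputable def irrToGroup : (Irr G → ℂ) →ₗ[ℂ] (G → ℂ) :=
  letI := Fintype.ofFinite (Irr G)
  { toFun := fun a g => (Nat.card G : ℂ)⁻¹ * ∑ χ, a χ * (χ.1 1 * χ.1 g⁻¹)
    map_add' := fun a b => by
      ext g
      simp [add_mul, Finset.sum_add_distrib, mul_add]
    map_smul' := fun c a => by
      ext g
      simp only [Pi.smul_apply, smul_eq_mul, mul_assoc, ← Finset.mul_sum, RingHom.id_apply]
      ring }

/-- The Fourier transform sending `f` to the values of the central characters of `G` at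
`∑ g, f g • g`. -/
noncomputable def groupToIrr : (G → ℂ) →ₗ[ℂ] (Irr G → ℂ) :=
  letI := Fintype.ofFinite G
  { toFun := fun f χ => (∑ g, f g * χ.1 g) / χ.1 1
    map_add' := fun a b => by
      ext χ
      simp [add_mul, Finset.sum_add_distrib, add_div]
    map_smul' := fun c a => by
      ext χ
      simp only [Pi.smul_apply, smul_eq_mul, mul_assoc, ← Finset.mul_sum, RingHom.id_apply,
        mul_div_assoc] }

theorem irrToGroup_apply [h : Fintype (Irr G)] (a : Irr G → ℂ) (g : G) :
    irrToGroup a g = (Nat.card G : ℂ)⁻¹ * ∑ χ, a χ * (χ.1 1 * χ.1 g⁻¹) := by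
  rw [Subsingleton.elim h (Fintype.ofFinite _)]
  rfl

theorem groupToIrr_apply [h : Fintype G] (f : G → ℂ) (χ : Irr G) :
    groupToIrr f χ = (∑ g, f g * χ.1 g) / χ.1 1 := by
  rw [Subsingleton.elim h (Fintype.ofFinite _)]
  rfl

theorem irrToGroup_conj (a : Irr G → ℂ) (g h : G) :
    irrToGroup a (h * g * h⁻¹) = irrToGroup a g := by
  have := Fintype.ofFinite (Irr G)
  have h1 : (h * g * h⁻¹)⁻¹ = h * g⁻¹ * h⁻¹ := by group
  simp only [irrToGroup_apply, h1, Irr.conj_invariant]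

theorem groupToIrr_irrToGroup (a : Irr G → ℂ) : groupToIrr (irrToGroup a) = a := by
  classical
  have := Fintype.ofFinite (Irr G)
  have := Fintype.ofFinite G
  have hcard : (Nat.card G : ℂ) ≠ 0 := Nat.cast_ne_zero.mpr Nat.card_pos.ne'
  ext χ
  rw [groupToIrr_apply, div_eq_iff χ.one_ne_zero]
  simp only [irrToGroup_apply, mul_assoc, ← Finset.mul_sum, Finset.sum_mul]
  rw [inv_mul_eq_iff_eq_mul₀ hcard, Finset.sum_comm, Finset.sum_eq_single χ]
  · simp only [← Finset.mul_sum, mul_comm (χ.1 _⁻¹), χ.sum_mul_inv]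
    ring
  · intro ψ _ hne
    have := not_not.mp (mt (irr_orthogonality χ ψ).mp hne.symm)
    simp only [← Finset.mul_sum, mul_comm (ψ.1 _⁻¹), this, mul_zero]
  · exact fun h => absurd (Finset.mem_univ _) h

/-- The difference of the two sides is a class function killed by `groupToIrr`, hence orthogonal to
every irreducible character. -/
theorem irrToGroup_groupToIrr {f : G → ℂ} (hf : ∀ g h, f (h * g * h⁻¹) = f g) :
    irrToGroup (groupToIrr f) = f := by
  have := Fintype.ofFinite G
  rw [← sub_eq_zero]
  refine eq_zero_of_forall_sum_irr_eq_zero _ (fun g h => ?_) fun χ => ?_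
  · simp [irrToGroup_conj, hf]
  · have h1 : groupToIrr (irrToGroup (groupToIrr f) - f) χ = 0 := by
      rw [map_sub, groupToIrr_irrToGroup, sub_self]
      rfl
    rw [groupToIrr_apply] at h1
    exact (div_eq_zero_iff.mp h1).resolve_right χ.one_ne_zero

theorem irrToGroup_indicator (X : Set (Irr G)) (g : G) :
    irrToGroup (X.indicator 1) g = (Nat.card G : ℂ)⁻¹ * star (sigma X g) := by
  classical
  have := Fintype.ofFinite (Irr G)
  have h : X.toFinite.toFinset = Finset.univ.filter (· ∈ X) := by ext; simp
  rw [irrToGroup_apply, sigma, h, star_sum, Finset.sum_filter]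
  refine congrArg _ (Finset.sum_congr rfl fun χ _ => ?_)
  rw [star_mul', Irr.star_one, Irr.inv_eq_star]
  simp [Set.indicator_apply]

theorem groupToIrr_indicator (K : Set G) (χ : Irr G) :
    groupToIrr (K.indicator 1) χ = omega χ K := by
  classical
  have := Fintype.ofFinite G
  have h : K.toFinite.toFinset = Finset.univ.filter (· ∈ K) := by ext; simp
  rw [groupToIrr_apply, omega, h, Finset.sum_filter]
  simp [Set.indicator_apply]

theorem classSetoid_classes (s : Setoid (Irr G)) :
    classSetoid s.classes = imageSetoid irrToGroup s := by
  have hcard : (Nat.card G : ℂ) ≠ 0 := Nat.cast_ne_zero.mpr Nat.card_pos.ne'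
  ext g h
  rw [imageSetoid_rel_iff]
  refine forall₂_congr fun X _ => ?_
  rw [irrToGroup_indicator, irrToGroup_indicator, mul_right_inj' (inv_ne_zero hcard), star_inj]

theorem irrSetoid_classes (r : Setoid G) :
    irrSetoid r.classes = imageSetoid groupToIrr r := by
  ext χ ψ
  rw [imageSetoid_rel_iff]
  refine forall₂_congr fun K _ => ?_
  rw [groupToIrr_indicator, groupToIrr_indicator]

end Transforms

/-! ### Fixed points of the iterations and supercharacter theories -/

section Iteration

variable {G : Type*} [Group G] [Finite G]

theorem iterate_Clpt_Irpt (r : Setoid G) (n : ℕ) :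
    (Clpt ∘ Irpt)^[n] r.classes =
      ((imageSetoid (irrToGroup (G := G)) ∘ imageSetoid groupToIrr)^[n] r).classes := by
  induction n with
  | zero => rfl
  | succ n ih =>
    rw [Function.iterate_succ_apply', Function.iterate_succ_apply', ih]
    simp only [Function.comp_apply, Clpt, Irpt, irrSetoid_classes, classSetoid_classes]

theorem iterate_Irpt_Clpt (s : Setoid (Irr G)) (n : ℕ) :
    (Irpt ∘ Clpt)^[n] s.classes =
      ((imageSetoid (groupToIrr (G := G)) ∘ imageSetoid irrToGroup)^[n] s).classes := by
  induction n with
  | zero => rfl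
  | succ n ih =>
    rw [Function.iterate_succ_apply', Function.iterate_succ_apply', ih]
    simp only [Function.comp_apply, Clpt, Irpt, irrSetoid_classes, classSetoid_classes]

theorem conj_imageSetoid_irrToGroup (s : Setoid (Irr G)) (g h : G) :
    imageSetoid irrToGroup s (h * g * h⁻¹) g :=
  fun _ _ => irrToGroup_conj _ _ _

theorem irrToGroup_groupToIrr_of_mem_constOn {r : Setoid G} (hr : ∀ g h : G, r (h * g * h⁻¹) g)
    {f : G → ℂ} (hf : f ∈ constOn r) : irrToGroup (groupToIrr f) = f :=
  irrToGroup_groupToIrr fun g h => hf _ _ (hr g h)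

theorem isSupercharacterTheory_classes_iff {s : Setoid (Irr G)} {r : Setoid G} :
    IsSupercharacterTheory s.classes r.classes ↔
      s.classes.ncard = r.classes.ncard ∧ r ≤ imageSetoid irrToGroup s := by
  rw [← classSetoid_classes]
  constructor
  · exact fun h => ⟨h.card_eq, fun x y hxy X hX =>
      h.const X hX _ (r.mem_classes y) x hxy y (r.refl y)⟩
  · rintro ⟨h1, h2⟩
    refine ⟨s.isPartition_classes, r.isPartition_classes, h1, ?_⟩
    rintro X hX _ ⟨y, rfl⟩ g hg h hh
    exact h2 (r.trans hg (r.symm hh)) X hX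

theorem IsSupercharacterTheory.le_imageSetoid {s : Setoid (Irr G)} {r : Setoid G}
    (h : IsSupercharacterTheory s.classes r.classes) :
    r ≤ imageSetoid irrToGroup s ∧ s ≤ imageSetoid groupToIrr r := by
  obtain ⟨h1, h2⟩ := isSupercharacterTheory_classes_iff.mp h
  exact ⟨h2, le_imageSetoid_of_ncard_eq (fun f _ => groupToIrr_irrToGroup f) h2 h1⟩

/-- A fixed point of the iteration on class partitions gives a supercharacter theory. -/
theorem isSupercharacterTheory_of_imageSetoid_eq {s : Setoid (Irr G)} {r : Setoid G}
    (hr : ∀ g h : G, r (h * g * h⁻¹) g) (h1 : imageSetoid groupToIrr r = s)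
    (h2 : imageSetoid irrToGroup s = r) : IsSupercharacterTheory s.classes r.classes := by
  -- Each transform is injective on block-constant functions, giving one inequality between the
  -- block counts.
  refine isSupercharacterTheory_classes_iff.mpr ⟨le_antisymm ?_ ?_, h2.ge⟩
  · conv_rhs => rw [← h2]
    exact ncard_classes_le_imageSetoid fun f _ => groupToIrr_irrToGroup f
  · rw [← h1]
    exact ncard_classes_le_imageSetoid fun f hf => irrToGroup_groupToIrr_of_mem_constOn hr hf

/-- Only `n = 0` needs the hypothesis: `irrToGroup` produces class functions, so later iterates are
invariant anyway. -/
theorem iterate_groupSetoid_rel_conj {r : Setoid G} (hr : ∀ g h : G, r (h * g * h⁻¹) g) (n : ℕ)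
    (g h : G) :
    ((imageSetoid irrToGroup ∘ imageSetoid groupToIrr)^[n] r) (h * g * h⁻¹) g := by
  cases n with
  | zero => exact hr g h
  | succ n =>
    rw [Function.iterate_succ_apply']
    exact conj_imageSetoid_irrToGroup _ g h

theorem iterate_groupSetoid_succ_le {r : Setoid G} (hr : ∀ g h : G, r (h * g * h⁻¹) g) (n : ℕ) :
    (imageSetoid irrToGroup ∘ imageSetoid groupToIrr)^[n + 1] r ≤
      (imageSetoid irrToGroup ∘ imageSetoid groupToIrr)^[n] r := by
  rw [Function.iterate_succ_apply']
  exact imageSetoid_imageSetoid_le fun f hf =>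
    irrToGroup_groupToIrr_of_mem_constOn (iterate_groupSetoid_rel_conj hr n) hf

theorem iterate_irrSetoid_succ_le (s : Setoid (Irr G)) (n : ℕ) :
    (imageSetoid groupToIrr ∘ imageSetoid irrToGroup)^[n + 1] s ≤
      (imageSetoid groupToIrr ∘ imageSetoid irrToGroup)^[n] s := by
  rw [Function.iterate_succ_apply']
  exact imageSetoid_imageSetoid_le fun f _ => groupToIrr_irrToGroup f

theorem isCoarsestSCT_refines_classPartition {r : Setoid G} (hr : ∀ g h : G, r (h * g * h⁻¹) g)
    {n : ℕ} (hn : (Clpt ∘ Irpt)^[n + 1] r.classes = (Clpt ∘ Irpt)^[n] r.classes) :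
    IsCoarsestSCT (fun _ ℒ => Refines ℒ r.classes)
      (Irpt ((Clpt ∘ Irpt)^[n] r.classes)) ((Clpt ∘ Irpt)^[n] r.classes) := by
  rw [iterate_Clpt_Irpt, iterate_Clpt_Irpt, ← Setoid.classes_inj] at hn
  rw [iterate_Clpt_Irpt, Irpt, irrSetoid_classes]
  have hinv := iterate_groupSetoid_rel_conj hr n
  have hanti := antitone_nat_of_succ_le
    (f := fun n => (imageSetoid irrToGroup ∘ imageSetoid groupToIrr)^[n] r)
    (iterate_groupSetoid_succ_le hr) n.zero_le
  rw [Function.iterate_succ_apply'] at hn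
  refine ⟨⟨isSupercharacterTheory_of_imageSetoid_eq hinv rfl hn,
    refines_classes_iff.mpr hanti⟩, fun 𝒴 ℒ h hℒ => ?_⟩
  obtain ⟨s, rfl⟩ := exists_classes_eq h.partition_irr
  obtain ⟨l, rfl⟩ := exists_classes_eq h.partition_group
  obtain ⟨h1, h2⟩ := h.le_imageSetoid
  -- Here `l ≤ C(s) ≤ C(I(l))`, so `l` stays below every iterate of the monotone map `CI` started at
  -- `r`.
  have hl := le_iterate_of_le
    ((imageSetoid_mono (irrToGroup (G := G))).comp (imageSetoid_mono groupToIrr))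
    (h1.trans (imageSetoid_mono _ h2)) (refines_classes_iff.mp hℒ) n
  exact ⟨refines_classes_iff.mpr (h2.trans (imageSetoid_mono _ hl)), refines_classes_iff.mpr hl⟩

theorem isCoarsestSCT_refines_irrPartition {s : Setoid (Irr G)}
    {n : ℕ} (hn : (Irpt ∘ Clpt)^[n + 1] s.classes = (Irpt ∘ Clpt)^[n] s.classes) :
    IsCoarsestSCT (fun 𝒴 _ => Refines 𝒴 s.classes)
      ((Irpt ∘ Clpt)^[n] s.classes) (Clpt ((Irpt ∘ Clpt)^[n] s.classes)) := by
  rw [iterate_Irpt_Clpt, iterate_Irpt_Clpt, ← Setoid.classes_inj] at hn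
  rw [iterate_Irpt_Clpt, Clpt, classSetoid_classes]
  have hanti := antitone_nat_of_succ_le
    (f := fun n => (imageSetoid groupToIrr ∘ imageSetoid irrToGroup)^[n] s)
    (iterate_irrSetoid_succ_le s) n.zero_le
  rw [Function.iterate_succ_apply'] at hn
  refine ⟨⟨isSupercharacterTheory_of_imageSetoid_eq (conj_imageSetoid_irrToGroup _) hn rfl,
    refines_classes_iff.mpr hanti⟩, fun 𝒴 ℒ h h𝒴 => ?_⟩
  obtain ⟨t, rfl⟩ := exists_classes_eq h.partition_irr
  obtain ⟨l, rfl⟩ := exists_classes_eq h.partition_group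
  obtain ⟨h1, h2⟩ := h.le_imageSetoid
  have ht := le_iterate_of_le
    ((imageSetoid_mono (groupToIrr (G := G))).comp (imageSetoid_mono irrToGroup))
    (h2.trans (imageSetoid_mono _ h1)) (refines_classes_iff.mp h𝒴) n
  exact ⟨refines_classes_iff.mpr ht, refines_classes_iff.mpr (h1.trans (imageSetoid_mono _ ht))⟩

end Iteration

end SCT

theorem mainTheorem6 {G : Type*} [Group G] [Finite G] :
    (∀ 𝒦 : Set (Set G), Setoid.IsPartition 𝒦 → SCT.IsInvariant 𝒦 →
      (∃ N : ℕ, ∀ n ≥ N, (SCT.Clpt ∘ SCT.Irpt)^[n] 𝒦 = (SCT.Clpt ∘ SCT.Irpt)^[N] 𝒦) ∧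
      ∀ n : ℕ, (SCT.Clpt ∘ SCT.Irpt)^[n + 1] 𝒦 = (SCT.Clpt ∘ SCT.Irpt)^[n] 𝒦 →
        SCT.IsCoarsestSCT (fun _ ℒ => SCT.Refines ℒ 𝒦)
          (SCT.Irpt ((SCT.Clpt ∘ SCT.Irpt)^[n] 𝒦)) ((SCT.Clpt ∘ SCT.Irpt)^[n] 𝒦)) ∧
    (∀ 𝒳 : Set (Set (SCT.Irr G)), Setoid.IsPartition 𝒳 →
      (∃ N : ℕ, ∀ n ≥ N, (SCT.Irpt ∘ SCT.Clpt)^[n] 𝒳 = (SCT.Irpt ∘ SCT.Clpt)^[N] 𝒳) ∧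
      ∀ n : ℕ, (SCT.Irpt ∘ SCT.Clpt)^[n + 1] 𝒳 = (SCT.Irpt ∘ SCT.Clpt)^[n] 𝒳 →
        SCT.IsCoarsestSCT (fun 𝒴 _ => SCT.Refines 𝒴 𝒳)
          ((SCT.Irpt ∘ SCT.Clpt)^[n] 𝒳) (SCT.Clpt ((SCT.Irpt ∘ SCT.Clpt)^[n] 𝒳))) := by
  constructor
  · intro 𝒦 h𝒦 hinv
    obtain ⟨r, rfl⟩ := SCT.exists_classes_eq h𝒦
    rw [SCT.isInvariant_classes_iff] at hinv
    refine ⟨?_, fun n hn => SCT.isCoarsestSCT_refines_classPartition hinv hn⟩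
    simp only [SCT.iterate_Clpt_Irpt, ← Setoid.classes_inj]
    exact SCT.eventually_const_iterate (SCT.iterate_groupSetoid_succ_le hinv)
  · intro 𝒳 h𝒳
    obtain ⟨s, rfl⟩ := SCT.exists_classes_eq h𝒳
    refine ⟨?_, fun n hn => SCT.isCoarsestSCT_refines_irrPartition hn⟩
    simp only [SCT.iterate_Irpt_Clpt, ← Setoid.classes_inj]
    exact SCT.eventually_const_iterate (SCT.iterate_irrSetoid_succ_le s)
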